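/- Let $\Gamma$ be a finite simple graph with vertex set $V(\Gamma)$, and let $$G(\Gamma)=\langle\, v\in V(\Gamma)\mid [u,v]=1 \text{ if } \{u,v\}\notin E(\Gamma)\,\rangle$$ be the right-angled Artin group in which non-adjacent generators commute. A letter is $v^{\pm1}$ with $v\in V(\Gamma)$, a word is a finite sequence of letters, and a word is reduced if it is a shortest word representing its element; $|g|$ is the length of a reduced word for $g$, and $\operatorname{supp}(g)$ is the set of $v\in V(\Gamma)$ such that $v$ or $v^{-1}$ occurs in a reduced word for $g$. A decomposition $g=g_1\cdots g_k$ is geodesic if $|g|=|g_1|+\cdots+|g_k|$; "$h=ap^nb$ is geodesic" refers to $h=a\cdot p\cdots p\cdot b$ with $n$ factors $p$, i.e. $|h|=|a|+n|p|+|b|$. An element $g$ is *strongly non-split* if $\operatorname{supp}(g)$ spans a connected subgraph of $\Gamma$ and there is no vertex $v\notin\operatorname{supp}(g)$ that is non-adjacent to every vertex of $\operatorname{supp}(g)$. It is *primitive* if $g\neq1$ and $g\ne u^n$ for all $n\ge2$ and $u\in G(\Gamma)$. Let $S(g)$ be the set of $v\in V(\Gamma)$ such that $g=v^{\epsilon}h$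 is geodesic for some $\epsilon=\pm1$ and $h\in G(\Gamma)$. Fix a linear order on $V(\Gamma)$. The element $g$ is *SD-conical* if $S(g)=\{v_0\}$ for a vertex $v_0$ that is adjacent to every vertex $v<v_0$. The *CGW-normal form* $\sigma(g)$ is the unique reduced word representing $g$ such that every nonempty suffix $w$ of it begins with $v^{\pm1}$, where $v$ is the largest element of $S(w)$ (the word $w$ being regarded as an element of $G(\Gamma)$). **Proposition.** Suppose that $\Gamma$ is connected, and let $$h=a_1p_1^{n_1}b_1=a_2p_2^{n_2}b_2$$ be two geodesic decompositions of $h\in G(\Gamma)$, where $n_i\ge3$ and $a_i,b_i,p_i\in G(\Gamma)$ for $i=1,2$. Suppose that $p_1$ and $p_2$ are strongly non-split, SD-conical and primitive, and that there exist non-negative real constants $A$ and $B$ such that $$|a_i|\le A,\qquad |b_i|\le B,\qquad |h|-(A+B)\ge 3|p_i|\qquad (i=1,2).$$ Then the words $\sigma(p_1)$ and $\sigma(p_2)$ are cyclically conjugate, i.e. $\sigma(p_1)\equiv w'w''$ and $\sigma(p_2)\equiv w''w'$ for some words $w',w''$. Furthermore, $a_1p_1a_1^{-1}=a_2p_2a_2^{-1}$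 and $b_1^{-1}p_1b_1=b_2^{-1}p_2b_2$. -/

import Mathlib

namespace RAAG

/-- Defining relators of `G(Γ)`: the commutators `[u, v]` of *non-adjacent* vertices. -/
def relators {V : Type*} (Γ : SimpleGraph V) : Set (FreeGroup V) :=
  {r | ∃ u v : V, ¬ Γ.Adj u v ∧
    r = FreeGroup.of u * FreeGroup.of v * (FreeGroup.of u)⁻¹ * (FreeGroup.of v)⁻¹}

/-- The right-angled Artin group `G(Γ) = ⟨ v ∈ V(Γ) | [u, v] = 1 if {u, v} ∉ E(Γ) ⟩`
(the convention in which non-adjacent generators commute). -/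
abbrev Grp {V : Type*} (Γ : SimpleGraph V) : Type _ := PresentedGroup (relators Γ)

/-- The generator of `G(Γ)` given by a vertex. -/
def gen {V : Type*} (Γ : SimpleGraph V) (v : V) : Grp Γ := PresentedGroup.of v

/-- The element given by a letter: `(v, true)` is `v` and `(v, false)` is `v⁻¹`. -/
def letter {V : Type*} (Γ : SimpleGraph V) (x : V × Bool) : Grp Γ :=
  if x.2 then gen Γ x.1 else (gen Γ x.1)⁻¹

/-- The element represented by a word, that is, by a finite sequence of letters. -/
def eval {V : Type*} (Γ : SimpleGraph V) (w : List (V × Bool)) : Grp Γ :=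
  (w.map (letter Γ)).prod

/-- A word is reduced if it is a shortest word among those representing the same element. -/
def IsReduced {V : Type*} (Γ : SimpleGraph V) (w : List (V × Bool)) : Prop :=
  ∀ w' : List (V × Bool), eval Γ w' = eval Γ w → w.length ≤ w'.length

/-- The word length `|g|`: the least length of a word representing `g`. -/
noncomputable def wordLength {V : Type*} {Γ : SimpleGraph V} (g : Grp Γ) : ℕ :=
  sInf {n : ℕ | ∃ w : List (V × Bool), eval Γ w = g ∧ w.length = n}

/-- The support of `g`: the vertices `v` such that `v` or `v⁻¹` occurs in a reduced word
representing `g`. -/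
def supp {V : Type*} {Γ : SimpleGraph V} (g : Grp Γ) : Set V :=
  {v | ∃ w : List (V × Bool), IsReduced Γ w ∧ eval Γ w = g ∧ ∃ b : Bool, (v, b) ∈ w}

/-- `g₁` and `g₂` disjointly commute: their supports are disjoint and every vertex in one
commutes with (is not adjacent to) every vertex in the other. -/
def DisjointlyCommute {V : Type*} {Γ : SimpleGraph V} (g₁ g₂ : Grp Γ) : Prop :=
  Disjoint (supp g₁) (supp g₂) ∧ ∀ v₁ ∈ supp g₁, ∀ v₂ ∈ supp g₂, ¬ Γ.Adj v₁ v₂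

/-- `g` is non-split if its support spans a connected subgraph of `Γ`. -/
def IsNonSplit {V : Type*} {Γ : SimpleGraph V} (g : Grp Γ) : Prop :=
  (Γ.induce (supp g)).Connected

/-- `g` is strongly non-split if it is non-split and no generator disjointly commutes with it. -/
def IsStronglyNonSplit {V : Type*} {Γ : SimpleGraph V} (g : Grp Γ) : Prop :=
  IsNonSplit g ∧ ¬ ∃ v : V, DisjointlyCommute (gen Γ v) g

/-- `g = g₁ ⋯ g_k` is a geodesic decomposition: `|g| = |g₁| + ⋯ + |g_k|`. -/
def IsGeodesicDecomposition {V : Type*} {Γ : SimpleGraph V} (g : Grp Γ) (l : List (Grp Γ)) :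
    Prop :=
  g = l.prod ∧ wordLength g = (l.map wordLength).sum

/-- `g` is primitive: nontrivial and not an `n`-th power with `n ≥ 2`. -/
def IsPrimitive {V : Type*} {Γ : SimpleGraph V} (g : Grp Γ) : Prop :=
  g ≠ 1 ∧ ∀ (n : ℕ) (u : Grp Γ), 2 ≤ n → g ≠ u ^ n

/-- The set `S(g)` of starting generators: the `v` such that `g = v^ε h` is geodesic for some
`ε = ±1` and some `h`. -/
def startingGenerators {V : Type*} {Γ : SimpleGraph V} (g : Grp Γ) : Set V :=
  {v | ∃ (b : Bool) (h : Grp Γ), IsGeodesicDecomposition g [letter Γ (v, b), h]}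

/-- `g` is `v₀`-conical, i.e. conical with apex `v₀`: `S(g) = {v₀}`. -/
def IsConicalAt {V : Type*} {Γ : SimpleGraph V} (g : Grp Γ) (v₀ : V) : Prop :=
  startingGenerators g = {v₀}

/-- `g` is SD-conical: it is conical and its apex is adjacent to every smaller vertex. -/
def IsSDConical {V : Type*} [LinearOrder V] {Γ : SimpleGraph V} (g : Grp Γ) : Prop :=
  ∃ v₀ : V, IsConicalAt g v₀ ∧ ∀ v : V, v < v₀ → Γ.Adj v v₀

/-- A reduced word is initially normal if it is empty or its first letter is `v^{±1}` with `v`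
the largest starting generator of the element it represents. -/
def IsInitiallyNormal {V : Type*} [LinearOrder V] (Γ : SimpleGraph V) (w : List (V × Bool)) :
    Prop :=
  IsReduced Γ w ∧ ∀ x ∈ w.head?, IsGreatest (startingGenerators (eval Γ w)) x.1

/-- A reduced word is normal if all its suffixes are initially normal. -/
def IsNormal {V : Type*} [LinearOrder V] (Γ : SimpleGraph V) (w : List (V × Bool)) : Prop :=
  IsReduced Γ w ∧ ∀ s : List (V × Bool), s <:+ w → IsInitiallyNormal Γ s

theorem eval_cons {V : Type*} (Γ : SimpleGraph V) (x : V × Bool) (w : List (V × Bool)) :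
    eval Γ (x :: w) = letter Γ x * eval Γ w := by
  simp [eval]

theorem exists_eval_eq {V : Type*} {Γ : SimpleGraph V} (g : Grp Γ) :
    ∃ w : List (V × Bool), eval Γ w = g := by
  obtain ⟨f, rfl⟩ := PresentedGroup.mk_surjective (relators Γ) g
  obtain ⟨w, rfl⟩ := Quot.exists_rep f
  refine ⟨w, ?_⟩
  change eval Γ w = PresentedGroup.mk (relators Γ) (FreeGroup.mk w)
  induction w with
  | nil => rfl
  | cons x t ih =>
    have hx : FreeGroup.mk (x :: t) = FreeGroup.mk [x] * FreeGroup.mk t := by simp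
    have hl : letter Γ x = PresentedGroup.mk (relators Γ) (FreeGroup.mk [x]) := by
      obtain ⟨v, b⟩ := x
      cases b
      · have : FreeGroup.mk [(v, false)] = (FreeGroup.of v)⁻¹ := rfl
        simp [letter, gen, this, PresentedGroup.of]
      · rfl
    rw [eval_cons, ih, hx, map_mul, hl]

theorem wordLength_le {V : Type*} {Γ : SimpleGraph V} (w : List (V × Bool)) :
    wordLength (eval Γ w) ≤ w.length :=
  Nat.sInf_le ⟨w, rfl, rfl⟩

theorem exists_length_eq {V : Type*} {Γ : SimpleGraph V} (g : Grp Γ) :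
    ∃ w : List (V × Bool), eval Γ w = g ∧ w.length = wordLength g := by
  have hne : {n : ℕ | ∃ w : List (V × Bool), eval Γ w = g ∧ w.length = n}.Nonempty := by
    obtain ⟨w, hw⟩ := exists_eval_eq g
    exact ⟨_, w, hw, rfl⟩
  exact Nat.sInf_mem hne

theorem isReduced_iff {V : Type*} {Γ : SimpleGraph V} (w : List (V × Bool)) :
    IsReduced Γ w ↔ w.length = wordLength (eval Γ w) := by
  constructor
  · intro h
    obtain ⟨w', h1, h2⟩ := exists_length_eq (eval Γ w)
    exact le_antisymm (h2 ▸ h w' h1) (wordLength_le w)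
  · intro h w' hw'
    rw [h, ← hw']
    exact wordLength_le w'

theorem wordLength_mul_le {V : Type*} {Γ : SimpleGraph V} (g h : Grp Γ) :
    wordLength (g * h) ≤ wordLength g + wordLength h := by
  obtain ⟨w, rfl, hw⟩ := exists_length_eq g
  obtain ⟨w', rfl, hw'⟩ := exists_length_eq h
  have : eval Γ w * eval Γ w' = eval Γ (w ++ w') := by simp [eval]
  rw [this, ← hw, ← hw', ← List.length_append]
  exact wordLength_le _

theorem gen_ne_one {V : Type*} (Γ : SimpleGraph V) (v : V) : gen Γ v ≠ 1 := by
  intro h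
  have hr : ∀ r ∈ relators Γ,
      FreeGroup.lift (fun _ : V => Multiplicative.ofAdd (1 : ℤ)) r = 1 := by
    rintro r ⟨a, b, -, rfl⟩
    simp
  have h2 := congrArg (PresentedGroup.toGroup hr) h
  have h3 : PresentedGroup.toGroup hr (gen Γ v) = Multiplicative.ofAdd (1 : ℤ) :=
    PresentedGroup.toGroup.of hr
  have h4 := (h3.symm.trans h2).trans (PresentedGroup.toGroup hr).map_one
  exact absurd h4 (by decide)

theorem wordLength_letter {V : Type*} (Γ : SimpleGraph V) (x : V × Bool) :
    wordLength (letter Γ x) = 1 := by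
  have h1 : wordLength (letter Γ x) ≤ 1 := by
    have := wordLength_le (Γ := Γ) [x]
    simpa [eval] using this
  have h0 : wordLength (letter Γ x) ≠ 0 := by
    intro h
    obtain ⟨w, hw, hl⟩ := exists_length_eq (letter Γ x)
    rw [h, List.length_eq_zero_iff] at hl
    subst hl
    have : letter Γ x = 1 := by rw [← hw]; rfl
    apply gen_ne_one Γ x.1
    unfold letter at this
    split at this
    · exact this
    · exact inv_eq_one.mp this
  omega

/-- Every element is represented by a normal word. -/
theorem exists_isNormal {V : Type*} [Finite V] [LinearOrder V] {Γ : SimpleGraph V} (g : Grp Γ) :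
    ∃ w : List (V × Bool), IsNormal Γ w ∧ eval Γ w = g := by
  induction hn : wordLength g using Nat.strong_induction_on generalizing g with
  | _ n ih =>
    subst hn
    obtain ⟨w, hw, hl⟩ := exists_length_eq g
    cases w with
    | nil =>
      refine ⟨[], ⟨fun _ _ => Nat.zero_le _, ?_⟩, hw⟩
      intro s hs
      rw [List.suffix_nil] at hs
      subst hs
      exact ⟨fun _ _ => Nat.zero_le _, by simp⟩
    | cons x t =>
      have hne : (startingGenerators g).Nonempty := by
        refine ⟨x.1, x.2, eval Γ t, ?_, ?_⟩
        · simp [← hw, eval_cons]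
        · have h1 := wordLength_le (Γ := Γ) t
          have h2 := wordLength_mul_le (letter Γ x) (eval Γ t)
          rw [← eval_cons, hw, wordLength_letter] at h2
          simp only [List.length_cons] at hl
          simp only [List.map_cons, List.map_nil, List.sum_cons, List.sum_nil, wordLength_letter]
          omega
      obtain ⟨v, ⟨b, h, hgh, hlen⟩, hmax⟩ := (Set.toFinite (startingGenerators g)).exists_maximal hne
      simp only [List.map_cons, List.map_nil, List.sum_cons, List.sum_nil, wordLength_letter,
        List.prod_cons, List.prod_nil, mul_one, add_zero] at hgh hlen
      obtain ⟨s, hs, hsh⟩ := ih (wordLength h) (by omega) h rfl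
      have hev : eval Γ ((v, b) :: s) = g := by rw [eval_cons, hsh, hgh]
      have hred : IsReduced Γ ((v, b) :: s) := by
        rw [isReduced_iff, hev, hlen, List.length_cons, (isReduced_iff s).mp hs.1, hsh, add_comm]
      refine ⟨(v, b) :: s, ⟨hred, ?_⟩, hev⟩
      intro u hu
      rcases List.suffix_cons_iff.mp hu with rfl | hu
      · refine ⟨hred, ?_⟩
        intro y hy
        simp only [List.head?_cons, Option.mem_def, Option.some.injEq] at hy
        subst hy
        rw [hev]
        refine ⟨⟨b, h, ?_, ?_⟩, fun c hc => ?_⟩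
        · simp [hgh]
        · simp [wordLength_letter, hlen]
        · rcases le_total c v with hcv | hcv
          · exact hcv
          · exact hmax hc hcv
      · exact hs.2 u hu

/-- The CGW-normal form `σ(g)`: the (unique) normal word representing `g`. -/
noncomputable def cgwNormalForm {V : Type*} [Finite V] [LinearOrder V] {Γ : SimpleGraph V}
    (g : Grp Γ) : List (V × Bool) :=
  Classical.choose (exists_isNormal g)

theorem cgwNormalForm_spec {V : Type*} [Finite V] [LinearOrder V] {Γ : SimpleGraph V}
    (g : Grp Γ) : IsNormal Γ (cgwNormalForm g) ∧ eval Γ (cgwNormalForm g) = g :=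
  Classical.choose_spec (exists_isNormal g)

end RAAG

/-!
Sending the generator `v` to the stable letter maps `G(Γ)` to an HNN extension whose stable letter
centralizes the link of `v`. There, Britton's lemma says that if two reduced words represent the
same element and one of them begins with `x`, then the other one contains `x` preceded only by
letters in the link of `x`. This determines the starting generators of a geodesic product, and
shows that `σ(ag) = σ(a)σ(g)` whenever `ag` is geodesic and `g` is SD-conical. If no generator
disjointly commutes with `p`, then `p` and a geodesic product `pg` have the same starting
generators, so `σ(a p^(n+1) b) = σ(a) σ(p)^n σ(pb)`.

Hence `σ(h)` contains two long periodic stretches, with periods `|p₁|` and `|p₂|`, which overlap in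
a word `W` of length `|p₁| + |p₂|`. By the theorem of Fine and Wilf, the prefixes of `W` of lengths
`|p₁|` and `|p₂|` are powers of one word `z`. If `T` is the part of `σ(h)` before `W`, then
`aᵢ pᵢ aᵢ⁻¹` is the conjugate by `T` of the corresponding prefix, so by primitivity both prefixes
are equal to `z`.
-/

namespace RAAG

variable {V : Type*} {Γ : SimpleGraph V}

section Words

variable {u w : List (V × Bool)} {x : V × Bool}

theorem eval_append (Γ : SimpleGraph V) (u w : List (V × Bool)) :
    eval Γ (u ++ w) = eval Γ u * eval Γ w := by
  simp [eval]

theorem eval_flatten_replicate (Γ : SimpleGraph V) (n : ℕ) (w : List (V × Bool)) :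
    eval Γ (List.replicate n w).flatten = eval Γ w ^ n := by
  induction n with
  | zero => simp [eval]
  | succ n ih => rw [List.replicate_succ, List.flatten_cons, eval_append, ih, pow_succ']

theorem letter_not (Γ : SimpleGraph V) (v : V) (b : Bool) :
    letter Γ (v, !b) = (letter Γ (v, b))⁻¹ := by
  cases b <;> simp [letter]

theorem exists_isReduced (g : Grp Γ) : ∃ w, IsReduced Γ w ∧ eval Γ w = g := by
  obtain ⟨w, rfl, hw⟩ := exists_length_eq g
  exact ⟨w, (isReduced_iff w).2 hw, rfl⟩

theorem IsReduced.wordLength_eval (hw : IsReduced Γ w) : wordLength (eval Γ w) = w.length :=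
  ((isReduced_iff w).1 hw).symm

theorem IsReduced.congr (hw : IsReduced Γ w) (heval : eval Γ u = eval Γ w)
    (hlen : u.length ≤ w.length) : IsReduced Γ u :=
  fun s hs => hlen.trans (hw s (hs.trans heval))

theorem IsReduced.of_infix (hw : IsReduced Γ w) (h : u <:+: w) : IsReduced Γ u := by
  obtain ⟨s, t, rfl⟩ := h
  intro u' hu'
  have hlen := hw (s ++ u' ++ t) (by simp only [eval_append, hu'])
  simp only [List.length_append] at hlen
  omega

theorem IsReduced.of_cons (hw : IsReduced Γ (x :: w)) : IsReduced Γ w :=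
  hw.of_infix (List.suffix_cons x w).isInfix

theorem isReduced_append (hu : IsReduced Γ u) (hw : IsReduced Γ w)
    (h : wordLength (eval Γ u * eval Γ w) = wordLength (eval Γ u) + wordLength (eval Γ w)) :
    IsReduced Γ (u ++ w) := by
  rw [isReduced_iff, eval_append, h, hu.wordLength_eval, hw.wordLength_eval, List.length_append]

theorem isReduced_singleton (Γ : SimpleGraph V) (x : V × Bool) : IsReduced Γ [x] := by
  rw [isReduced_iff, eval_cons, show eval Γ [] = 1 from rfl, mul_one, wordLength_letter]
  rfl

theorem wordLength_pow_mul_le (p g : Grp Γ) (n : ℕ) :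
    wordLength (p ^ n * g) ≤ n * wordLength p + wordLength g := by
  induction n with
  | zero => simp
  | succ n ih =>
    rw [pow_succ', mul_assoc]
    linarith [wordLength_mul_le p (p ^ n * g)]

end Words

section UniversalProperty

theorem gen_commute {u v : V} (h : ¬ Γ.Adj u v) : Commute (gen Γ u) (gen Γ v) := by
  have hrel := PresentedGroup.one_of_mem (rels := relators Γ) ⟨u, v, h, rfl⟩
  simp only [map_mul, map_inv] at hrel
  exact mul_inv_eq_iff_eq_mul.1 (mul_inv_eq_one.1 hrel)

variable {H : Type*} [Group H]

/-- The universal property of `G(Γ)`: the homomorphism extending an assignment of pairwise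
commuting elements to non-adjacent vertices. -/
def lift (f : V → H) (hf : ∀ u v, ¬ Γ.Adj u v → Commute (f u) (f v)) : Grp Γ →* H :=
  PresentedGroup.toGroup (f := f) <| by
    rintro r ⟨u, v, huv, rfl⟩
    simp only [map_mul, map_inv, FreeGroup.lift_apply_of]
    rw [(hf u v huv).eq, mul_inv_cancel_right, mul_inv_cancel]

theorem lift_gen (f : V → H) (hf : ∀ u v, ¬ Γ.Adj u v → Commute (f u) (f v)) (v : V) :
    lift f hf (gen Γ v) = f v :=
  PresentedGroup.toGroup.of _

end UniversalProperty

section SpecialSubgroups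

variable {S : Set V} {v : V} {g : Grp Γ} {w : List (V × Bool)}

/-- The special (standard parabolic) subgroup of `G(Γ)` generated by a set of vertices. -/
def specialSubgroup (Γ : SimpleGraph V) (S : Set V) : Subgroup (Grp Γ) :=
  Subgroup.closure (gen Γ '' S)

theorem letter_mem_specialSubgroup (h : v ∈ S) (b : Bool) :
    letter Γ (v, b) ∈ specialSubgroup Γ S := by
  have hv : gen Γ v ∈ specialSubgroup Γ S := Subgroup.subset_closure (Set.mem_image_of_mem _ h)
  cases b
  · exact inv_mem hv
  · exact hv

theorem eval_mem_specialSubgroup (h : ∀ x ∈ w, x.1 ∈ S) : eval Γ w ∈ specialSubgroup Γ S := by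
  refine Subgroup.list_prod_mem _ fun g hg => ?_
  obtain ⟨x, hx, rfl⟩ := List.mem_map.1 hg
  exact letter_mem_specialSubgroup (h x hx) x.2

open Classical in
/-- The retraction of `G(Γ)` onto the special subgroup of `S`, killing the vertices outside `S`. -/
noncomputable def retraction (Γ : SimpleGraph V) (S : Set V) : Grp Γ →* Grp Γ :=
  lift (fun v => if v ∈ S then gen Γ v else 1) fun u v huv => by
    split_ifs
    exacts [gen_commute huv, Commute.one_right _, Commute.one_left _, Commute.one_left _]

theorem retraction_eq_self (h : g ∈ specialSubgroup Γ S) : retraction Γ S g = g := by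
  refine MonoidHom.eqOn_closure (f := retraction Γ S) (g := MonoidHom.id _) ?_ h
  rintro _ ⟨v, hv, rfl⟩
  simp [retraction, lift_gen, hv]

open Classical in
theorem retraction_letter (Γ : SimpleGraph V) (S : Set V) (x : V × Bool) :
    retraction Γ S (letter Γ x) = if x.1 ∈ S then letter Γ x else 1 := by
  obtain ⟨v, _ | _⟩ := x <;> by_cases hv : v ∈ S <;> simp [retraction, letter, lift_gen, hv]

open Classical in
theorem retraction_eval (Γ : SimpleGraph V) (S : Set V) (w : List (V × Bool)) :
    retraction Γ S (eval Γ w) = eval Γ (w.filter (·.1 ∈ S)) := by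
  induction w with
  | nil => exact map_one _
  | cons x w ih =>
    rw [eval_cons, map_mul, ih, retraction_letter]
    by_cases hx : x.1 ∈ S <;> simp [hx, eval_cons]

theorem IsReduced.fst_mem (hw : IsReduced Γ w) (h : eval Γ w ∈ specialSubgroup Γ S) :
    ∀ x ∈ w, x.1 ∈ S := by
  classical
  have hlen := hw (w.filter (·.1 ∈ S)) (by rw [← retraction_eval, retraction_eq_self h])
  have hfilter := (List.filter_sublist (p := (·.1 ∈ S)) (l := w)).eq_of_length_le hlen
  simpa using List.filter_eq_self.1 hfilter

theorem supp_eval (hw : IsReduced Γ w) : supp (eval Γ w) = {v | ∃ b, (v, b) ∈ w} := by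
  ext v
  refine ⟨?_, fun hv => ⟨w, hw, rfl, hv⟩⟩
  rintro ⟨u, hu, heval, b, hb⟩
  have hmem : eval Γ u ∈ specialSubgroup Γ {v | ∃ b, (v, b) ∈ w} :=
    heval ▸ eval_mem_specialSubgroup fun x hx => ⟨x.2, hx⟩
  exact hu.fst_mem hmem _ hb

theorem supp_subset_iff : supp g ⊆ S ↔ g ∈ specialSubgroup Γ S := by
  obtain ⟨w, hw, rfl⟩ := exists_isReduced g
  rw [supp_eval hw]
  refine ⟨fun h => eval_mem_specialSubgroup fun x hx => h ⟨x.2, hx⟩, ?_⟩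
  rintro h v ⟨b, hb⟩
  exact hw.fst_mem h _ hb

theorem supp_gen (Γ : SimpleGraph V) (v : V) : supp (gen Γ v) = {v} := by
  have hgen : gen Γ v = eval Γ [(v, true)] := by simp [eval, letter]
  rw [hgen, supp_eval (isReduced_singleton Γ _)]
  ext u
  simp

/-- The special subgroup of the vertices other than `v` whose generators commute with `v`. -/
def linkSubgroup (Γ : SimpleGraph V) (v : V) : Subgroup (Grp Γ) :=
  specialSubgroup Γ (Γᶜ.neighborSet v)

theorem disjointlyCommute_gen_iff : DisjointlyCommute (gen Γ v) g ↔ g ∈ linkSubgroup Γ v := by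
  rw [linkSubgroup, ← supp_subset_iff, DisjointlyCommute, supp_gen, Set.disjoint_singleton_left]
  simp only [Set.mem_singleton_iff, forall_eq, Set.subset_def, SimpleGraph.mem_neighborSet,
    SimpleGraph.compl_adj]
  exact ⟨fun h u hu => ⟨fun huv => h.1 (huv ▸ hu), h.2 u hu⟩,
    fun h => ⟨fun hv => (h v hv).1 rfl, fun u hu => (h u hu).2⟩⟩

theorem commute_letter_of_mem_linkSubgroup (h : g ∈ linkSubgroup Γ v) (b : Bool) :
    Commute (letter Γ (v, b)) g := by
  have hgen : Commute (gen Γ v) g := by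
    have hle : linkSubgroup Γ v ≤ Subgroup.centralizer {gen Γ v} := by
      refine (Subgroup.closure_le _).2 ?_
      rintro _ ⟨u, hu, rfl⟩
      exact Subgroup.mem_centralizer_singleton_iff.2 (gen_commute hu.2).symm.eq
    exact (Subgroup.mem_centralizer_singleton_iff.1 (hle h)).symm
  cases b
  · exact hgen.inv_left
  · exact hgen

end SpecialSubgroups

section Exchange

open HNNExtension HNNExtension.NormalWord

/-- The HNN extension of `G(Γ)` by a stable letter centralizing the link of `v`. Only Britton's
lemma is applied to it, so the base group need not be cut down to the special subgroup of the
vertices other than `v`, over which `G(Γ)` itself is such an extension. -/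
abbrev LinkHNN (Γ : SimpleGraph V) (v : V) : Type _ :=
  HNNExtension (Grp Γ) (linkSubgroup Γ v) (linkSubgroup Γ v) (MulEquiv.refl _)

theorem commute_t_of {v : V} {g : Grp Γ} (h : g ∈ linkSubgroup Γ v) :
    Commute (t : LinkHNN Γ v) (of g) :=
  t_mul_of ⟨g, h⟩

open Classical in
/-- The homomorphism replacing the generator `v` by the stable letter. -/
noncomputable def toLinkHNN (Γ : SimpleGraph V) (v : V) : Grp Γ →* LinkHNN Γ v :=
  lift (fun u => if u = v then t else of (gen Γ u)) fun a b hab => by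
    have hlink {u : V} (hu : u ≠ v) (h : ¬ Γ.Adj v u) : Commute (t : LinkHNN Γ v) (of (gen Γ u)) :=
      commute_t_of (Subgroup.subset_closure ⟨u, ⟨hu.symm, h⟩, rfl⟩)
    split_ifs with ha hb hb
    · exact Commute.refl _
    · exact hlink hb (ha ▸ hab)
    · exact (hlink ha fun h => hab (hb ▸ h.symm)).symm
    · exact (gen_commute hab).map of

/-- The exponent of the letters `(v, b)`, as a unit of `ℤ`. -/
def exponent (b : Bool) : ℤˣ := if b then 1 else -1

theorem exponent_injective : Function.Injective exponent := by decide

theorem toLinkHNN_letter_self (Γ : SimpleGraph V) (v : V) (b : Bool) :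
    toLinkHNN Γ v (letter Γ (v, b)) = t ^ (exponent b : ℤ) := by
  cases b <;> simp [toLinkHNN, letter, lift_gen, exponent]

theorem toLinkHNN_letter_of_ne {v : V} {x : V × Bool} (h : x.1 ≠ v) :
    toLinkHNN Γ v (letter Γ x) = of (letter Γ x) := by
  obtain ⟨u, _ | _⟩ := x <;> simp_all [toLinkHNN, letter, lift_gen]

variable {v : V} {x : V × Bool} {u w : List (V × Bool)}

theorem IsReduced.eq_of_eval_mem_linkSubgroup {b c : Bool}
    (h : IsReduced Γ ((v, b) :: u ++ (v, c) :: w)) (hu : eval Γ u ∈ linkSubgroup Γ v) : b = c := by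
  by_contra hbc
  obtain rfl : c = !b := by revert hbc; cases b <;> cases c <;> decide
  have heval : eval Γ (u ++ w) = eval Γ ((v, b) :: u ++ (v, !b) :: w) := by
    rw [List.cons_append, eval_cons, eval_append, eval_append, eval_cons, letter_not, ← mul_assoc,
      (commute_letter_of_mem_linkSubgroup hu b).eq, mul_assoc, mul_inv_cancel_left]
  have hlen := h _ heval
  simp only [List.cons_append, List.length_cons, List.length_append] at hlen
  omega

theorem IsReduced.exists_reducedWord [DecidableEq V] (v : V) (hw : IsReduced Γ w) :
    ∃ r : ReducedWord (Grp Γ) (linkSubgroup Γ v) (linkSubgroup Γ v),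
      r.prod (MulEquiv.refl _) = toLinkHNN Γ v (eval Γ w) ∧
      r.head = eval Γ (w.takeWhile (·.1 ≠ v)) ∧
      r.toList.head?.map Prod.fst =
        (w.dropWhile (·.1 ≠ v)).head?.map fun x => exponent x.2 := by
  induction w with
  | nil => exact ⟨ReducedWord.empty _ _ _, by simp [ReducedWord.prod, eval], rfl, rfl⟩
  | cons x w ih =>
    obtain ⟨r, hprod, hhead, hexp⟩ := ih hw.of_cons
    obtain ⟨a, b⟩ := x
    by_cases hx : a = v
    · subst hx
      refine ⟨⟨1, (exponent b, r.head) :: r.toList, List.isChain_cons.2 ⟨?_, r.chain⟩⟩, ?_, ?_, ?_⟩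
      · intro y hy hmem
        rw [Option.mem_def.1 hy, Option.map_some] at hexp
        obtain ⟨⟨c, d⟩, hz, hyd⟩ := Option.map_eq_some_iff.1 hexp.symm
        have hca := List.head?_dropWhile_not (·.1 ≠ a) w
        rw [hz] at hca
        obtain rfl : c = a := by simpa using hca
        obtain ⟨w', hw'⟩ := List.head?_eq_some_iff.1 hz
        rw [← List.takeWhile_append_dropWhile (p := (·.1 ≠ c)) (l := w), hw'] at hw
        rw [hw.eq_of_eval_mem_linkSubgroup (by simpa [hhead, toSubgroup] using hmem), hyd]
      · rw [eval_cons, map_mul, ← hprod, toLinkHNN_letter_self]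
        simp [ReducedWord.prod, mul_assoc]
      · simp [eval]
      · simp
    · refine ⟨⟨letter Γ (a, b) * r.head, r.toList, r.chain⟩, ?_, ?_, ?_⟩
      · rw [eval_cons, map_mul, ← hprod, toLinkHNN_letter_of_ne hx]
        simp [ReducedWord.prod, mul_assoc]
      · simp [hx, eval_cons, hhead]
      · simpa [hx] using hexp

theorem IsReduced.exists_eq_append_cons (hw : IsReduced Γ w) (hu : IsReduced Γ (x :: u))
    (h : eval Γ w = eval Γ (x :: u)) :
    ∃ w₁ w₂, w = w₁ ++ x :: w₂ ∧ eval Γ w₁ ∈ linkSubgroup Γ x.1 := by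
  classical
  obtain ⟨r, hrprod, hrhead, hrexp⟩ := hw.exists_reducedWord x.1
  obtain ⟨s, hsprod, hshead, hsexp⟩ := hu.exists_reducedWord x.1
  obtain ⟨hexp, hmem⟩ := ReducedWord.map_fst_eq_and_of_prod_eq (MulEquiv.refl _)
    (hsprod.trans (h ▸ hrprod.symm))
  have hs : s.toList.head?.map Prod.fst = some (exponent x.2) := by simpa using hsexp
  have hhead : (w.dropWhile (·.1 ≠ x.1)).head? = some x := by
    rw [← List.head?_map, ← hexp, List.head?_map, hs] at hrexp
    obtain ⟨y, hy, hyx⟩ := Option.map_eq_some_iff.1 hrexp.symm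
    have hfst := List.head?_dropWhile_not (·.1 ≠ x.1) w
    rw [hy] at hfst
    rw [hy, Prod.ext (by simpa using hfst) (exponent_injective hyx)]
  obtain ⟨w₂, hw₂⟩ := List.head?_eq_some_iff.1 hhead
  refine ⟨w.takeWhile (·.1 ≠ x.1), w₂, ?_, ?_⟩
  · rw [← hw₂, List.takeWhile_append_dropWhile]
  · simpa [hshead, hrhead, eval, toSubgroup] using hmem _ hs

end Exchange

section StartingGenerators

variable {g h : Grp Γ} {v : V} {w : List (V × Bool)}

theorem mem_startingGenerators_iff_exists_isReduced :
    v ∈ startingGenerators g ↔ ∃ b u, IsReduced Γ ((v, b) :: u) ∧ eval Γ ((v, b) :: u) = g := by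
  simp only [startingGenerators, IsGeodesicDecomposition, Set.mem_ofPred_eq, List.prod_cons,
    List.prod_nil, mul_one, List.map_cons, List.map_nil, List.sum_cons, List.sum_nil, add_zero,
    wordLength_letter]
  constructor
  · rintro ⟨b, h, rfl, hlen⟩
    obtain ⟨u, hu, rfl⟩ := exists_isReduced h
    refine ⟨b, u, ?_, eval_cons Γ _ _⟩
    rw [isReduced_iff, eval_cons, hlen, hu.wordLength_eval, List.length_cons, add_comm]
  · rintro ⟨b, u, hu, rfl⟩
    refine ⟨b, eval Γ u, eval_cons Γ _ _, ?_⟩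
    rw [hu.wordLength_eval, hu.of_cons.wordLength_eval, List.length_cons, add_comm]

theorem mem_startingGenerators_eval_iff (hw : IsReduced Γ w) :
    v ∈ startingGenerators (eval Γ w) ↔
      ∃ b w₁ w₂, w = w₁ ++ (v, b) :: w₂ ∧ eval Γ w₁ ∈ linkSubgroup Γ v := by
  rw [mem_startingGenerators_iff_exists_isReduced]
  constructor
  · rintro ⟨b, u, hu, heval⟩
    exact ⟨b, hw.exists_eq_append_cons hu heval.symm⟩
  · rintro ⟨b, w₁, w₂, rfl, hmem⟩
    have heval : eval Γ ((v, b) :: (w₁ ++ w₂)) = eval Γ (w₁ ++ (v, b) :: w₂) := by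
      rw [eval_cons, eval_append, eval_append, eval_cons, ← mul_assoc, ← mul_assoc,
        (commute_letter_of_mem_linkSubgroup hmem b).eq]
    exact ⟨b, w₁ ++ w₂, hw.congr heval (by simp), heval⟩

theorem mem_startingGenerators_mul_iff (hgh : wordLength (g * h) = wordLength g + wordLength h) :
    v ∈ startingGenerators (g * h) ↔
      v ∈ startingGenerators g ∨ g ∈ linkSubgroup Γ v ∧ v ∈ startingGenerators h := by
  obtain ⟨u, hu, rfl⟩ := exists_isReduced g
  obtain ⟨w, hw, rfl⟩ := exists_isReduced h
  have huw := isReduced_append hu hw hgh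
  rw [← eval_append, mem_startingGenerators_eval_iff huw, mem_startingGenerators_eval_iff hu,
    mem_startingGenerators_eval_iff hw]
  constructor
  · rintro ⟨b, w₁, w₂, hsplit, hmem⟩
    rcases List.append_eq_append_iff.1 hsplit with ⟨s, rfl, rfl⟩ | ⟨s, rfl, hs⟩
    · have hfst := (huw.of_infix (u := u ++ s) ⟨[], (v, b) :: w₂, by simp⟩).fst_mem hmem
      exact Or.inr ⟨eval_mem_specialSubgroup fun x hx => hfst x (List.mem_append_left _ hx),
        b, s, w₂, rfl, eval_mem_specialSubgroup fun x hx => hfst x (List.mem_append_right _ hx)⟩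
    · cases s with
      | nil => exact Or.inr ⟨by simpa using hmem, b, [], w₂, hs.symm, one_mem _⟩
      | cons y s =>
        obtain ⟨rfl, -⟩ := List.cons_eq_cons.1 hs
        exact Or.inl ⟨b, w₁, s, rfl, hmem⟩
  · rintro (⟨b, w₁, w₂, rfl, hmem⟩ | ⟨hlink, b, w₁, w₂, rfl, hmem⟩)
    · exact ⟨b, w₁, w₂ ++ w, by simp, hmem⟩
    · exact ⟨b, u ++ w₁, w₂, by simp, by simpa [eval_append] using mul_mem hlink hmem⟩

theorem startingGenerators_mul (hg : ∀ v, g ∉ linkSubgroup Γ v)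
    (hgh : wordLength (g * h) = wordLength g + wordLength h) :
    startingGenerators (g * h) = startingGenerators g := by
  ext v
  simp [mem_startingGenerators_mul_iff hgh, hg v]

theorem IsStronglyNonSplit.notMem_linkSubgroup (hg : IsStronglyNonSplit g) (v : V) :
    g ∉ linkSubgroup Γ v :=
  fun hmem => hg.2 ⟨v, disjointlyCommute_gen_iff.2 hmem⟩

theorem IsSDConical.mul [LinearOrder V] (hg : IsSDConical g) (hlink : ∀ v, g ∉ linkSubgroup Γ v)
    (hgh : wordLength (g * h) = wordLength g + wordLength h) : IsSDConical (g * h) := by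
  obtain ⟨v₀, hv₀, hmin⟩ := hg
  exact ⟨v₀, (startingGenerators_mul hlink hgh).trans hv₀, hmin⟩

end StartingGenerators

section NormalForms

variable [LinearOrder V] {x : V × Bool} {u w : List (V × Bool)} {g p a b : Grp Γ} {n : ℕ}

theorem isNormal_cons :
    IsNormal Γ (x :: w) ↔ IsReduced Γ (x :: w) ∧
      IsGreatest (startingGenerators (eval Γ (x :: w))) x.1 ∧ IsNormal Γ w := by
  constructor
  · rintro ⟨hred, hsuffix⟩
    exact ⟨hred, (hsuffix _ List.suffix_rfl).2 x rfl, hred.of_cons,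
      fun s hs => hsuffix s (hs.trans (List.suffix_cons x w))⟩
  · rintro ⟨hred, hgreatest, hw⟩
    refine ⟨hred, fun s hs => ?_⟩
    rcases List.suffix_cons_iff.1 hs with rfl | hs
    · exact ⟨hred, by simpa using hgreatest⟩
    · exact hw.2 s hs

theorem IsNormal.eq_of_eval_eq (hu : IsNormal Γ u) (hw : IsNormal Γ w)
    (heval : eval Γ u = eval Γ w) : u = w := by
  induction u generalizing w with
  | nil => exact (List.eq_nil_of_length_eq_zero (Nat.le_zero.1 (hw.1 [] heval))).symm
  | cons x u ih =>
    cases w with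
    | nil => exact List.eq_nil_of_length_eq_zero (Nat.le_zero.1 (hu.1 [] heval.symm))
    | cons y w =>
      obtain ⟨hxu, hx, hu'⟩ := isNormal_cons.1 hu
      obtain ⟨hyw, hy, hw'⟩ := isNormal_cons.1 hw
      have hfst : y.1 = x.1 := hy.unique (heval ▸ hx)
      obtain ⟨w₁, w₂, hsplit, hmem⟩ := hyw.exists_eq_append_cons hxu heval.symm
      cases w₁ with
      | nil =>
        obtain ⟨rfl, -⟩ := List.cons_eq_cons.1 hsplit
        rw [eval_cons, eval_cons, mul_right_inj] at heval
        rw [ih hu' hw' heval]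
      | cons z w₁ =>
        obtain ⟨rfl, rfl⟩ := List.cons_eq_cons.1 hsplit
        have hw₁ := hyw.of_infix (List.prefix_append (y :: w₁) _).isInfix
        exact ((hw₁.fst_mem hmem y List.mem_cons_self).1 hfst.symm).elim

theorem IsNormal.append (hu : IsNormal Γ u) (hw : IsNormal Γ w) (hsd : IsSDConical (eval Γ w))
    (huw : IsReduced Γ (u ++ w)) : IsNormal Γ (u ++ w) := by
  induction u with
  | nil => exact hw
  | cons x u ih =>
    obtain ⟨hxu, hx, hu⟩ := isNormal_cons.1 hu
    refine isNormal_cons.2 ⟨huw, ?_, ih hu huw.of_cons⟩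
    have hlen : wordLength (eval Γ (x :: u) * eval Γ w) =
        wordLength (eval Γ (x :: u)) + wordLength (eval Γ w) := by
      rw [← eval_append, huw.wordLength_eval, hxu.wordLength_eval, hw.1.wordLength_eval,
        List.length_append]
    change IsGreatest (startingGenerators (eval Γ (x :: u ++ w))) x.1
    rw [eval_append]
    refine ⟨(mem_startingGenerators_mul_iff hlen).2 (Or.inl hx.1), fun v hv => ?_⟩
    rcases (mem_startingGenerators_mul_iff hlen).1 hv with hv | ⟨hlink, hv⟩
    · exact hx.2 hv
    -- A starting generator of `w` is its apex, hence adjacent to `x.1` if larger than `x.1`; but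
    -- it commutes with every letter of `x :: u`.
    · obtain ⟨v₀, hv₀, hmin⟩ := hsd
      obtain rfl : v = v₀ := Set.mem_singleton_iff.1 (hv₀.le hv)
      by_contra! hlt
      exact (hxu.fst_mem hlink x List.mem_cons_self).2 (hmin _ hlt).symm

theorem IsSDConical.pow_mul (hp : IsSDConical p) (hlink : ∀ v, p ∉ linkSubgroup Γ v)
    (hg : IsSDConical g) (hlen : wordLength (p ^ n * g) = n * wordLength p + wordLength g) :
    IsSDConical (p ^ n * g) := by
  cases n with
  | zero => simpa
  | succ n =>
    have hle := wordLength_pow_mul_le p g n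
    rw [pow_succ', mul_assoc] at hlen ⊢
    exact hp.mul hlink <| le_antisymm (wordLength_mul_le _ _) (by linarith)

variable [Finite V]

theorem isNormal_cgwNormalForm (g : Grp Γ) : IsNormal Γ (cgwNormalForm g) :=
  (cgwNormalForm_spec g).1

theorem eval_cgwNormalForm (g : Grp Γ) : eval Γ (cgwNormalForm g) = g :=
  (cgwNormalForm_spec g).2

theorem length_cgwNormalForm (g : Grp Γ) : (cgwNormalForm g).length = wordLength g := by
  rw [← (isNormal_cgwNormalForm g).1.wordLength_eval, eval_cgwNormalForm]

theorem cgwNormalForm_mul (hg : IsSDConical g)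
    (hlen : wordLength (a * g) = wordLength a + wordLength g) :
    cgwNormalForm (a * g) = cgwNormalForm a ++ cgwNormalForm g := by
  have ha := isNormal_cgwNormalForm a
  have hg' := isNormal_cgwNormalForm g
  refine (isNormal_cgwNormalForm _).eq_of_eval_eq (ha.append hg' ?_ ?_) ?_
  · rwa [eval_cgwNormalForm]
  · exact isReduced_append ha.1 hg'.1 (by simpa only [eval_cgwNormalForm])
  · simp only [eval_append, eval_cgwNormalForm]

theorem cgwNormalForm_pow_mul (hp : IsSDConical p) (hlink : ∀ v, p ∉ linkSubgroup Γ v)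
    (hg : IsSDConical g) (hlen : wordLength (p ^ n * g) = n * wordLength p + wordLength g) :
    cgwNormalForm (p ^ n * g) =
      (List.replicate n (cgwNormalForm p)).flatten ++ cgwNormalForm g := by
  induction n with
  | zero => simp
  | succ n ih =>
    have hle := wordLength_pow_mul_le p g n
    have hmul := wordLength_mul_le p (p ^ n * g)
    rw [pow_succ', mul_assoc] at hlen ⊢
    have hlen' : wordLength (p ^ n * g) = n * wordLength p + wordLength g := by linarith
    rw [cgwNormalForm_mul (hp.pow_mul hlink hg hlen') (by linarith), ih hlen',
      List.replicate_succ, List.flatten_cons, List.append_assoc]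

theorem cgwNormalForm_mul_pow_succ_mul (hp : IsSDConical p) (hlink : ∀ v, p ∉ linkSubgroup Γ v)
    (hlen : wordLength (a * p ^ (n + 1) * b) =
      wordLength a + (n + 1) * wordLength p + wordLength b) :
    cgwNormalForm (a * p ^ (n + 1) * b) =
      cgwNormalForm a ++ (List.replicate n (cgwNormalForm p)).flatten ++
        cgwNormalForm (p * b) := by
  have hpb := wordLength_mul_le p b
  have hpow := wordLength_pow_mul_le p (p * b) n
  have ha := wordLength_mul_le a (p ^ n * (p * b))
  rw [pow_succ, mul_assoc, mul_assoc] at hlen ⊢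
  have hlen_pb : wordLength (p * b) = wordLength p + wordLength b := by linarith
  have hlen_pow : wordLength (p ^ n * (p * b)) = n * wordLength p + wordLength (p * b) := by
    linarith
  have hsd := hp.mul hlink hlen_pb
  rw [cgwNormalForm_mul (hp.pow_mul hlink hsd hlen_pow) (by linarith),
    cgwNormalForm_pow_mul hp hlink hsd hlen_pow, List.append_assoc]

end NormalForms

section PeriodicWords

open List

variable {α : Type*}

theorem hasPeriod_flatten_replicate (n : ℕ) (q : List α) :
    (replicate n q).flatten.HasPeriod q.length := by
  cases n with
  | zero => simp
  | succ n =>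
    have hprefix : (replicate n q).flatten <+: (replicate (n + 1) q).flatten := by
      rw [replicate_succ', flatten_concat]
      exact prefix_append _ _
    rw [List.HasPeriod, replicate_succ, flatten_cons, take_left, prefix_append_right_inj]
    simpa [replicate_succ] using hprefix

theorem take_mul_eq_flatten_replicate {w : List α} {d k : ℕ} (hw : w.HasPeriod d)
    (hk : k * d ≤ w.length) : w.take (k * d) = (replicate k (w.take d)).flatten := by
  induction k with
  | zero => simp
  | succ k ih =>
    have hkd : k * d + d ≤ w.length := by linarith
    have hdrop : (w.drop d).take (k * d) = w.take (k * d) := by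
      obtain ⟨s, hs⟩ := hw.drop_prefix
      conv_rhs => rw [← hs]
      rw [take_append_of_le_length (by simp; omega)]
    rw [replicate_succ, flatten_cons, ← ih (by omega), ← hdrop, ← take_add, add_one_mul, add_comm]

theorem exists_flatten_replicate_eq_take {w : List α} {m n : ℕ} (hlen : m + n ≤ w.length)
    (hm : (w.take (m + n)).HasPeriod m) (hn : (w.take (m + n)).HasPeriod n) :
    ∃ z j k, w.take m = (replicate j z).flatten ∧ w.take n = (replicate k z).flatten := by
  have hgcd := hm.gcd hn (by simp; omega)
  have hroot {d : ℕ} (hd : m.gcd n ∣ d) (hdmn : d ≤ m + n) :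
      ∃ k, w.take d = (replicate k ((w.take (m + n)).take (m.gcd n))).flatten := by
    obtain ⟨k, rfl⟩ := hd
    refine ⟨k, ?_⟩
    rw [mul_comm, ← take_mul_eq_flatten_replicate hgcd (by simp; lia), take_take,
      min_eq_left (by lia)]
  obtain ⟨j, hj⟩ := hroot (Nat.gcd_dvd_left m n) (Nat.le_add_right m n)
  obtain ⟨k, hk⟩ := hroot (Nat.gcd_dvd_right m n) (Nat.le_add_left n m)
  exact ⟨_, j, k, hj, hk⟩

theorem isRotated_take_drop_flatten_replicate {n k : ℕ} {q : List α}
    (h : k + q.length ≤ n * q.length) :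
    ((replicate n q).flatten.drop k).take q.length ~r q := by
  induction n generalizing k with
  | zero => simp_all
  | succ n ih =>
    rw [replicate_succ, flatten_cons]
    rcases le_or_gt q.length k with hk | hk
    · rw [drop_append, drop_eq_nil_of_le hk, nil_append]
      exact ih (by lia)
    · have htake : (replicate n q).flatten.take k = q.take k := by
        cases n with
        | zero =>
          obtain rfl : k = 0 := by omega
          simp
        | succ n => rw [replicate_succ, flatten_cons, take_append_of_le_length hk.le]
      rw [drop_append_of_le_length hk.le, take_append, take_of_length_le (by simp), length_drop,
        Nat.sub_sub_self hk.le, htake]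
      simpa using isRotated_append (l := q.drop k) (l' := q.take k)

theorem take_add_flatten_replicate {n k : ℕ} {q : List α} (h : k + q.length ≤ n * q.length) :
    (replicate n q).flatten.take (k + q.length) = q ++ (replicate n q).flatten.take k := by
  cases n with
  | zero => simp_all
  | succ n =>
    rw [replicate_succ, flatten_cons, add_comm k, take_length_add_append, ← flatten_cons,
      ← replicate_succ, replicate_succ', flatten_concat,
      take_append_of_le_length (by simp; lia)]

theorem take_drop_append {u w v : List α} {s l : ℕ} (hu : u.length ≤ s)
    (hl : s + l ≤ u.length + w.length) :
    ((u ++ w ++ v).drop s).take l = (w.drop (s - u.length)).take l := by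
  rw [append_assoc, drop_append, drop_eq_nil_of_le hu, nil_append,
    drop_append_of_le_length (by omega), take_append_of_le_length (by simp; omega)]

end PeriodicWords

section Axes

open List

theorem inv_mul_mul_eq_conj {G : Type*} [Group G] (a p b : G) (n : ℕ) :
    b⁻¹ * p * b = (a * p ^ n * b)⁻¹ * (a * p * a⁻¹) * (a * p ^ n * b) := by
  calc b⁻¹ * p * b = b⁻¹ * ((p ^ n)⁻¹ * (p ^ n * p)) * b := by rw [inv_mul_cancel_left]
    _ = b⁻¹ * ((p ^ n)⁻¹ * (p * p ^ n)) * b := by rw [pow_mul_comm']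
    _ = (a * p ^ n * b)⁻¹ * (a * p * a⁻¹) * (a * p ^ n * b) := by group

theorem IsPrimitive.eq_one_of_conj_eq {p a x z : Grp Γ} {k : ℕ} (hp : IsPrimitive p)
    (h : a * p * a⁻¹ = x * z ^ k * x⁻¹) : k = 1 := by
  have hpow : p = (a⁻¹ * x * z * (a⁻¹ * x)⁻¹) ^ k :=
    calc p = a⁻¹ * (a * p * a⁻¹) * a := by group
      _ = a⁻¹ * x * z ^ k * (a⁻¹ * x)⁻¹ := by rw [h]; group
      _ = (a⁻¹ * x * z * (a⁻¹ * x)⁻¹) ^ k := conj_pow.symm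
  by_contra hk
  obtain rfl | hk : k = 0 ∨ 2 ≤ k := by omega
  · exact hp.1 (hpow.trans (pow_zero _))
  · exact hp.2 k _ hk hpow

theorem isGeodesicDecomposition_pow_iff {h a p b : Grp Γ} {n : ℕ} :
    IsGeodesicDecomposition h ([a] ++ replicate n p ++ [b]) ↔
      h = a * p ^ n * b ∧ wordLength h = wordLength a + n * wordLength p + wordLength b := by
  simp [IsGeodesicDecomposition, mul_assoc, add_assoc]

variable {u q v : List (V × Bool)} {n s : ℕ}

theorem eval_take_mul_eval_take_drop (hu : u.length ≤ s)
    (hs : s + q.length ≤ u.length + n * q.length) :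
    eval Γ ((u ++ (replicate n q).flatten ++ v).take s) *
        eval Γ (((u ++ (replicate n q).flatten ++ v).drop s).take q.length) =
      eval Γ u * eval Γ q * (eval Γ u)⁻¹ *
        eval Γ ((u ++ (replicate n q).flatten ++ v).take s) := by
  obtain ⟨k, rfl⟩ := Nat.exists_eq_add_of_le hu
  have htake {l : ℕ} (hl : l ≤ n * q.length) :
      (u ++ (replicate n q).flatten ++ v).take (u.length + l) =
        u ++ (replicate n q).flatten.take l := by
    rw [append_assoc, take_length_add_append, take_append_of_le_length (by simpa using hl)]
  rw [← eval_append, ← take_add, add_assoc, htake (by omega), htake (by omega),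
    take_add_flatten_replicate (by omega)]
  simp only [eval_append, mul_assoc, inv_mul_cancel_left]

variable [LinearOrder V] [Finite V] {h a p b : Grp Γ} {l : ℕ}

theorem cgwNormalForm_periodic_window (hp : IsSDConical p) (hlink : ∀ v, p ∉ linkSubgroup Γ v)
    (hgeo : IsGeodesicDecomposition h ([a] ++ replicate (n + 1) p ++ [b]))
    (ha : wordLength a ≤ s) (hpl : wordLength p ≤ l)
    (hl : s + l + wordLength p + wordLength b ≤ wordLength h) :
    (((cgwNormalForm h).drop s).take l).HasPeriod (wordLength p) ∧
      ((cgwNormalForm h).drop s).take (wordLength p) ~r cgwNormalForm p ∧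
      a * p * a⁻¹ = eval Γ ((cgwNormalForm h).take s) *
        eval Γ (((cgwNormalForm h).drop s).take (wordLength p)) *
        (eval Γ ((cgwNormalForm h).take s))⁻¹ := by
  obtain ⟨rfl, hlen⟩ := isGeodesicDecomposition_pow_iff.1 hgeo
  have hle : s + l ≤ (cgwNormalForm a).length + n * (cgwNormalForm p).length := by
    simp only [length_cgwNormalForm]
    linarith
  rw [cgwNormalForm_mul_pow_succ_mul hp hlink hlen]
  rw [← length_cgwNormalForm] at ha hpl
  rw [← length_cgwNormalForm p]
  refine ⟨?_, ?_, ?_⟩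
  · rw [take_drop_append ha (by simpa using hle)]
    exact (hasPeriod_flatten_replicate n _).infix
      ((take_prefix _ _).isInfix.trans (drop_suffix _ _).isInfix)
  · rw [take_drop_append ha (by simp; omega)]
    exact isRotated_take_drop_flatten_replicate (by omega)
  · rw [eval_take_mul_eval_take_drop ha (by omega), mul_inv_cancel_right]
    simp only [eval_cgwNormalForm]

variable {a₁ p₁ b₁ a₂ p₂ b₂ : Grp Γ} {n₁ n₂ : ℕ}

theorem isRotated_and_conj_eq_of_geodesic
    (hgeo₁ : IsGeodesicDecomposition h ([a₁] ++ replicate (n₁ + 1) p₁ ++ [b₁]))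
    (hgeo₂ : IsGeodesicDecomposition h ([a₂] ++ replicate (n₂ + 1) p₂ ++ [b₂]))
    (hlink₁ : ∀ v, p₁ ∉ linkSubgroup Γ v) (hlink₂ : ∀ v, p₂ ∉ linkSubgroup Γ v)
    (hsd₁ : IsSDConical p₁) (hsd₂ : IsSDConical p₂)
    (hpr₁ : IsPrimitive p₁) (hpr₂ : IsPrimitive p₂)
    (ha₁ : wordLength a₁ ≤ s) (ha₂ : wordLength a₂ ≤ s)
    (hlen₁ : s + (wordLength p₁ + wordLength p₂) + wordLength p₁ + wordLength b₁ ≤ wordLength h)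
    (hlen₂ : s + (wordLength p₁ + wordLength p₂) + wordLength p₂ + wordLength b₂ ≤ wordLength h) :
    cgwNormalForm p₁ ~r cgwNormalForm p₂ ∧ a₁ * p₁ * a₁⁻¹ = a₂ * p₂ * a₂⁻¹ := by
  obtain ⟨hper₁, hrot₁, hconj₁⟩ :=
    cgwNormalForm_periodic_window hsd₁ hlink₁ hgeo₁ ha₁ (Nat.le_add_right _ _) hlen₁
  obtain ⟨hper₂, hrot₂, hconj₂⟩ :=
    cgwNormalForm_periodic_window hsd₂ hlink₂ hgeo₂ ha₂ (Nat.le_add_left _ _) hlen₂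
  obtain ⟨z, j, k, hj, hk⟩ := exists_flatten_replicate_eq_take
    (by rw [length_drop, length_cgwNormalForm]; omega) hper₁ hper₂
  obtain rfl := hpr₁.eq_one_of_conj_eq (by rwa [hj, eval_flatten_replicate] at hconj₁)
  obtain rfl := hpr₂.eq_one_of_conj_eq (by rwa [hk, eval_flatten_replicate] at hconj₂)
  rw [hj] at hrot₁ hconj₁
  rw [hk] at hrot₂ hconj₂
  exact ⟨hrot₁.symm.trans hrot₂, hconj₁.trans hconj₂.symm⟩

end Axes

end RAAG

theorem mainTheorem4 {V : Type*} [Finite V] [LinearOrder V] (Γ : SimpleGraph V)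
    (hΓ : Γ.Connected) (h a₁ p₁ b₁ a₂ p₂ b₂ : RAAG.Grp Γ) (n₁ n₂ : ℕ)
    (hn₁ : 3 ≤ n₁) (hn₂ : 3 ≤ n₂)
    (hgeo₁ : RAAG.IsGeodesicDecomposition h ([a₁] ++ List.replicate n₁ p₁ ++ [b₁]))
    (hgeo₂ : RAAG.IsGeodesicDecomposition h ([a₂] ++ List.replicate n₂ p₂ ++ [b₂]))
    (hns₁ : RAAG.IsStronglyNonSplit p₁) (hns₂ : RAAG.IsStronglyNonSplit p₂)
    (hsd₁ : RAAG.IsSDConical p₁) (hsd₂ : RAAG.IsSDConical p₂)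
    (hpr₁ : RAAG.IsPrimitive p₁) (hpr₂ : RAAG.IsPrimitive p₂)
    (A B : ℝ) (hA : 0 ≤ A) (hB : 0 ≤ B)
    (ha₁ : (RAAG.wordLength a₁ : ℝ) ≤ A) (ha₂ : (RAAG.wordLength a₂ : ℝ) ≤ A)
    (hb₁ : (RAAG.wordLength b₁ : ℝ) ≤ B) (hb₂ : (RAAG.wordLength b₂ : ℝ) ≤ B)
    (hp₁ : 3 * (RAAG.wordLength p₁ : ℝ) ≤ (RAAG.wordLength h : ℝ) - (A + B))
    (hp₂ : 3 * (RAAG.wordLength p₂ : ℝ) ≤ (RAAG.wordLength h : ℝ) - (A + B)) :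
    (RAAG.cgwNormalForm p₁).IsRotated (RAAG.cgwNormalForm p₂) ∧
      a₁ * p₁ * a₁⁻¹ = a₂ * p₂ * a₂⁻¹ ∧
      b₁⁻¹ * p₁ * b₁ = b₂⁻¹ * p₂ * b₂ := by
  obtain ⟨m₁, rfl⟩ : ∃ m, n₁ = m + 1 := ⟨n₁ - 1, by omega⟩
  obtain ⟨m₂, rfl⟩ : ∃ m, n₂ = m + 1 := ⟨n₂ - 1, by omega⟩
  have ha : (max (RAAG.wordLength a₁) (RAAG.wordLength a₂) : ℝ) ≤ A := max_le ha₁ ha₂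
  obtain ⟨hrot, hconj⟩ := RAAG.isRotated_and_conj_eq_of_geodesic hgeo₁ hgeo₂
    hns₁.notMem_linkSubgroup hns₂.notMem_linkSubgroup hsd₁ hsd₂ hpr₁ hpr₂
    (le_max_left _ _) (le_max_right _ _)
    (by rify; linarith) (by rify; linarith)
  refine ⟨hrot, hconj, ?_⟩
  have hh₁ := (RAAG.isGeodesicDecomposition_pow_iff.1 hgeo₁).1
  have hh₂ := (RAAG.isGeodesicDecomposition_pow_iff.1 hgeo₂).1
  rw [RAAG.inv_mul_mul_eq_conj a₁ p₁ b₁, RAAG.inv_mul_mul_eq_conj a₂ p₂ b₂, ← hh₁, ← hh₂, hconj]
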